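/- Let $G=(V,E)$ be a finite directed acyclic graph with unit-capacity edges (parallel edges allowed), and let $(s_i,t_i)$, $i=1,2,3$, be three pairs of nodes of $G$; sources, or terminals, of different pairs may coincide. Let $k_i$ be the maximum value of a flow from $s_i$ to $t_i$ in $G$, so that $[k_1~k_2~k_3]$ is the connectivity level of the instance. If $k_1\ge 1$, $k_2\ge 3$ and $k_3\ge 3$, then the multiple unicast instance $\langle G,\{s_i-t_i\}_{1}^{3}\rangle$ with unit-entropy sources is feasible, that is, it has a vector linear network coding solution: there are a finite field $\mathbb{F}$, an integer $T\ge 1$, and $T\times T$ matrices $A_{e',e}$ (for edges $e',e$ with $\mathrm{head}(e')=\mathrm{tail}(e)$) and $B_{j,e}$ (for $s_j=\mathrm{tail}(e)$) over $\mathbb{F}$ such that, for the edge signals $Y_e\in\mathbb{F}^T$ determined from the source messages $X_1,X_2,X_3\in\mathbb{F}^T$ by $$Y_e=\sum_{e':\,\mathrm{head}(e')=\mathrm{tail}(e)}A_{e',e}Y_{e'}+\sum_{j:\,s_j=\mathrm{tail}(e)}B_{j,e}X_j ,$$ each terminal $t_i$ can recover $X_i$ from the signals $Y_e$ on the edges $e$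 with $\mathrm{head}(e)=t_i$, whatever the messages $X_1,X_2,X_3$ are. -/

import Mathlib

/-- A multiple unicast instance with `n` unit-entropy sessions: a directed acyclic multigraph with
vertices `V` and unit-capacity edges `E` (parallel edges are allowed), and for each session a source
node and a terminal node. Sources, as well as terminals, of different sessions may be collocated. -/
structure MultipleUnicast (V E : Type*) (n : ℕ) where
  tail : E → V
  head : E → V
  acyclic : ∀ v : V, ¬ Relation.TransGen (fun a b => ∃ e : E, tail e = a ∧ head e = b) v v
  source : Fin n → V
  terminal : Fin n → V

namespace MultipleUnicast

variable {V E : Type*} [Fintype E] {n : ℕ}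

open Classical in
/-- Total value of `f` on the edges entering `v`. -/
noncomputable def inflow (I : MultipleUnicast V E n) (f : E → ℝ) (v : V) : ℝ :=
  ∑ e with I.head e = v, f e

open Classical in
/-- Total value of `f` on the edges leaving `v`. -/
noncomputable def outflow (I : MultipleUnicast V E n) (f : E → ℝ) (v : V) : ℝ :=
  ∑ e with I.tail e = v, f e

/-- `f` is a flow from `s` to `t`, all edges having capacity one. -/
structure IsFlow (I : MultipleUnicast V E n) (s t : V) (f : E → ℝ) : Prop where
  nonneg : ∀ e, 0 ≤ f e
  le_one : ∀ e, f e ≤ 1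
  conservation : ∀ v, v ≠ s → v ≠ t → I.inflow f v = I.outflow f v

/-- The set of values (net amounts leaving `s`) of the flows from `s` to `t`. -/
def flowValues (I : MultipleUnicast V E n) (s t : V) : Set ℝ :=
  {r | ∃ f : E → ℝ, I.IsFlow s t f ∧ I.outflow f s - I.inflow f s = r}

/-- The maximum value of a flow from `s` to `t`. -/
noncomputable def maxFlow (I : MultipleUnicast V E n) (s t : V) : ℝ :=
  sSup (I.flowValues s t)

/-- The supremum in the definition of `maxFlow` is a maximum. -/
theorem isGreatest_maxFlow (I : MultipleUnicast V E n) (s t : V) :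
    IsGreatest (I.flowValues s t) (I.maxFlow s t) := by
  classical
  have hin : ∀ v, Continuous fun f : E → ℝ => I.inflow f v := fun v => by
    unfold inflow; fun_prop
  have hout : ∀ v, Continuous fun f : E → ℝ => I.outflow f v := fun v => by
    unfold outflow; fun_prop
  have hset : {f | I.IsFlow s t f} = Set.Icc (0 : E → ℝ) 1 ∩
      ⋂ v, ⋂ (_ : v ≠ s), ⋂ (_ : v ≠ t), {f | I.inflow f v = I.outflow f v} := by
    ext f
    simp only [Set.mem_ofPred_eq, Set.mem_inter_iff, Set.mem_Icc, Set.mem_iInter]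
    exact ⟨fun h => ⟨⟨h.1, h.2⟩, h.3⟩, fun h => ⟨h.1.1, h.1.2, h.2⟩⟩
  have hc : IsCompact {f | I.IsFlow s t f} := by
    rw [hset]
    refine isCompact_Icc.inter_right ?_
    exact isClosed_iInter fun v => isClosed_iInter fun _ => isClosed_iInter fun _ =>
      isClosed_eq (hin v) (hout v)
  have himg : I.flowValues s t =
      (fun f : E → ℝ => I.outflow f s - I.inflow f s) '' {f | I.IsFlow s t f} := rfl
  have hne : (I.flowValues s t).Nonempty :=
    ⟨_, 0, ⟨fun _ => le_rfl, fun _ => zero_le_one, fun v _ _ => by simp [inflow, outflow]⟩, rfl⟩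
  rw [maxFlow]
  have hcomp : IsCompact (I.flowValues s t) := by
    rw [himg]; exact hc.image ((hout s).sub (hin s))
  exact hcomp.isGreatest_sSup hne

/-- The connectivity level: the vector of the maximum flows of the sessions. -/
noncomputable def connectivityLevel (I : MultipleUnicast V E n) : Fin n → ℝ :=
  fun i => I.maxFlow (I.source i) (I.terminal i)

/-- The local coefficients of a vector linear network code of length `T` over `F`.
Only `edgeCoeff e' e` with `head e' = tail e` and `sourceCoeff j e` with `source j = tail e`
are ever used. -/
structure VectorLinearCode (I : MultipleUnicast V E n) (F : Type*) (T : ℕ) where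
  edgeCoeff : E → E → Matrix (Fin T) (Fin T) F
  sourceCoeff : Fin n → E → Matrix (Fin T) (Fin T) F

open Classical in
/-- `Y` gives the signals on the edges (`T` symbols on each edge) as a function of the source
messages `X` (`T` symbols for each source): the signal on an edge is the prescribed linear
combination of the signals on the edges entering its tail and of the messages observed at its tail.
As the graph is finite and acyclic, a code determines `Y` uniquely. -/
def VectorLinearCode.IsSignal {I : MultipleUnicast V E n} {F : Type*} [Field F] {T : ℕ}
    (c : I.VectorLinearCode F T) (Y : (Fin n → Fin T → F) → E → Fin T → F) : Prop :=
  ∀ X e, Y X e =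
    (∑ e' with I.head e' = I.tail e, (c.edgeCoeff e' e).mulVec (Y X e')) +
      ∑ j with I.source j = I.tail e, (c.sourceCoeff j e).mulVec (X j)

/-- There is a vector linear network code of length `T` over `F` such that every terminal recovers
the message of its source from the signals on the edges that enter the terminal. -/
def HasVectorLinearSolution (I : MultipleUnicast V E n) (F : Type*) [Field F] (T : ℕ) : Prop :=
  ∃ (c : I.VectorLinearCode F T) (Y : (Fin n → Fin T → F) → E → Fin T → F), c.IsSignal Y ∧
    ∀ i, ∃ decode : ({e : E // I.head e = I.terminal i} → Fin T → F) → Fin T → F,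
      ∀ X, decode (fun e => Y X e) = X i

/-- The instance has a vector linear network coding solution over some finite field and some
positive number of time units (one time unit being the scalar case). -/
def IsFeasible (I : MultipleUnicast V E n) : Prop :=
  ∃ (F : Type) (_ : Field F) (_ : Finite F) (T : ℕ), 0 < T ∧ I.HasVectorLinearSolution F T

end MultipleUnicast

/-! Use two time units. The first serves session 0 at rate 1 and session 1 at rate 2, the second
serves session 0 at rate 1 and session 2 at rate 2; in total every session receives two symbols. It
remains to serve two sessions at rates 1 and 2 when their connectivities are 1 and 3.

Take three edge-disjoint paths from s to t, with edge set `D`, and a path from s' to t'. If the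
latter avoids `D`, route separately (`hasIntegralCode_of_free`). Otherwise let `e` be its last edge
in `D` (`hasIntegralCode_of_last`). Upstream of `e`, mix the message y of s' into the network;
downstream of `e`, add nothing more to the paths and forward the signal of `e` to t' outside `D`.
Thus t' and t both see the signal of `e`, which is l(x) + c y. Restricting x to the kernel of l
costs s one of its three dimensions. Then t' reads y, and t, knowing y, inverts its transfer matrix
(`HasIntegralCode.hasScalarCode`).

Coefficients are first chosen in ℤ: nonnegativity prevents cancellation in c, and even multipliers
on `D` make the transfer determinant odd. Reduction modulo a large prime keeps both nonzero. -/

namespace MultipleUnicast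

open Relation

/-! ### Flows, cuts and decomposition into paths -/

section Flows

variable {V E : Type*} [Fintype E] {n : ℕ}

/-- The net amount of `f` leaving `v`. -/
noncomputable def net (I : MultipleUnicast V E n) (f : E → ℝ) (v : V) : ℝ :=
  I.outflow f v - I.inflow f v

open Classical in
theorem net_eq_sum (I : MultipleUnicast V E n) (f : E → ℝ) (v : V) :
    I.net f v = ∑ e, ((if I.tail e = v then f e else 0) - if I.head e = v then f e else 0) := by
  simp [net, outflow, inflow, Finset.sum_filter]

-- Edges with both ends in `S` cancel, so only edges across the cut count.
open Classical in
theorem sum_net (I : MultipleUnicast V E n) (f : E → ℝ) (S : Finset V) :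
    ∑ v ∈ S, I.net f v =
      ∑ e, ((if I.tail e ∈ S then f e else 0) - if I.head e ∈ S then f e else 0) := by
  simp_rw [net_eq_sum]
  rw [Finset.sum_comm]
  refine Finset.sum_congr rfl fun e _ => ?_
  simp [Finset.sum_sub_distrib]

theorem net_add (I : MultipleUnicast V E n) (f g : E → ℝ) (v : V) :
    I.net (f + g) v = I.net f v + I.net g v := by
  simp only [net, outflow, inflow, Pi.add_apply, Finset.sum_add_distrib]
  ring

open Classical in
theorem net_single (I : MultipleUnicast V E n) (e : E) (c : ℝ) (v : V) :
    I.net (Pi.single e c) v =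
      (if I.tail e = v then c else 0) - if I.head e = v then c else 0 := by
  rw [net_eq_sum, Finset.sum_eq_single e]
  · simp
  · intro b _ hb
    simp [Pi.single_eq_of_ne hb]
  · simp

-- Conservation removes every node of `S` except `s`. The alternative `s = t` serves to show that
-- such a flow has value zero.
open Classical in
theorem IsFlow.sum_net_eq {I : MultipleUnicast V E n} {s t : V} {f : E → ℝ}
    (hf : I.IsFlow s t f) {S : Finset V} (hs : s ∈ S) (ht : t ∉ S ∨ s = t) :
    ∑ v ∈ S, I.net f v = I.net f s := by
  refine Finset.sum_eq_single_of_mem s hs fun v hv hvs => ?_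
  have hvt : v ≠ t := by
    rintro rfl
    rcases ht with ht | ht
    · exact ht hv
    · exact hvs ht.symm
  rw [net, hf.conservation v hvs hvt, sub_self]

/-- A flow of nonzero value has distinct end nodes. -/
theorem IsFlow.ne [Finite V] {I : MultipleUnicast V E n} {s t : V} {f : E → ℝ}
    (hf : I.IsFlow s t f) (h : I.net f s ≠ 0) : s ≠ t := by
  classical
  have := Fintype.ofFinite V
  intro hst
  apply h
  rw [← hf.sum_net_eq (Finset.mem_univ s) (Or.inr hst), sum_net]
  simp

/-- The adjacency relation between nodes. -/
def Adj (I : MultipleUnicast V E n) (a b : V) : Prop := ∃ e : E, I.tail e = a ∧ I.head e = b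

/-- A flow of positive value is only possible to a reachable node. -/
theorem IsFlow.reachable [Finite V] {I : MultipleUnicast V E n} {s t : V} {f : E → ℝ}
    (hf : I.IsFlow s t f) (h : 0 < I.net f s) : ReflTransGen I.Adj s t := by
  classical
  have := Fintype.ofFinite V
  by_contra hst
  -- No edge leaves the set of reachable nodes, so the net flow out of it is at most zero.
  have h1 := hf.sum_net_eq (S := Finset.univ.filter fun v => ReflTransGen I.Adj s v)
    (by simp [ReflTransGen.refl]) (Or.inl (by simpa using hst))
  rw [sum_net] at h1
  have h2 : ∀ e ∈ Finset.univ, ((if I.tail e ∈ Finset.univ.filter (fun v => ReflTransGen I.Adj s v)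
      then f e else 0) - if I.head e ∈ Finset.univ.filter (fun v => ReflTransGen I.Adj s v)
      then f e else 0) ≤ 0 := by
    intro e _
    have h3 : ReflTransGen I.Adj s (I.tail e) → ReflTransGen I.Adj s (I.head e) :=
      fun h => h.tail ⟨e, rfl, rfl⟩
    have h4 := hf.nonneg e
    simp only [Finset.mem_filter, Finset.mem_univ, true_and]
    split_ifs with a b <;> first | linarith | exact absurd (h3 a) b
  linarith [Finset.sum_nonpos h2]

/-- The arcs of the residual graph of a `0`-`1` valued function. -/
def Residual (I : MultipleUnicast V E n) (g : E → ℝ) (u w : V) : Prop :=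
  ∃ e, (g e = 0 ∧ I.tail e = u ∧ I.head e = w) ∨ (g e = 1 ∧ I.head e = u ∧ I.tail e = w)

/-- A walk from `u` can be shortened to one that leaves `u` for good at once. -/
theorem eq_or_exists_avoiding {r : V → V → Prop} {u v : V} (h : ReflTransGen r u v) :
    u = v ∨ ∃ w, r u w ∧ ReflTransGen (fun a b => r a b ∧ a ≠ u ∧ b ≠ u) w v := by
  -- Going backwards from `v`, either `u` has not been met yet or its last departure has been found.
  have key : ∀ a, ReflTransGen r a v →
      u = v ∨ ReflTransGen (fun a b => r a b ∧ a ≠ u ∧ b ≠ u) a v ∧ a ≠ u ∨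
        ∃ w, r u w ∧ ReflTransGen (fun a b => r a b ∧ a ≠ u ∧ b ≠ u) w v := by
    intro a ha
    induction ha using ReflTransGen.head_induction_on with
    | refl =>
      by_cases h : u = v
      · exact Or.inl h
      · exact Or.inr (Or.inl ⟨.refl, Ne.symm h⟩)
    | @head a b hab _ ih =>
      rcases ih with ih | ⟨ih, hb⟩ | ih
      · exact Or.inl ih
      · by_cases hau : a = u
        · exact Or.inr (Or.inr ⟨b, hau ▸ hab, ih⟩)
        · exact Or.inr (Or.inl ⟨ih.head ⟨hab, hau, hb⟩, hau⟩)
      · exact Or.inr (Or.inr ih)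
  rcases key u h with h | ⟨_, h⟩ | h
  · exact Or.inl h
  · exact absurd rfl h
  · exact Or.inr h

open Classical in
/-- Augmentation along a residual path from `u` to `v`. -/
theorem exists_augment [Fintype V] (I : MultipleUnicast V E n) (A : Finset V) (g : E → ℝ)
    (hg : ∀ e, g e = 0 ∨ g e = 1) (u v : V)
    (h : ReflTransGen (fun a b => I.Residual g a b ∧ a ∉ A ∧ b ∉ A) u v) :
    ∃ g' : E → ℝ, (∀ e, g' e = 0 ∨ g' e = 1) ∧ ∀ x, I.net g' x =
      I.net g x + ((if u = x then 1 else 0) - if v = x then 1 else 0) := by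
  -- `A` collects the nodes already left for good, so its complement shrinks at each step.
  induction hn : Aᶜ.card using Nat.strong_induction_on generalizing A g u with
  | _ m ih =>
    subst hn
    rcases eq_or_exists_avoiding h with rfl | ⟨w, ⟨⟨e, he⟩, huA, -⟩, hwv⟩
    · exact ⟨g, hg, by simp⟩
    have hlt : (insert u A)ᶜ.card < Aᶜ.card := by
      apply Finset.card_lt_card
      rw [Finset.compl_ssubset_compl]
      exact Finset.ssubset_insert huA
    -- Adding `1 - 2 * g e` flips the value on `e` between 0 and 1.
    set g₁ : E → ℝ := g + Pi.single e (1 - 2 * g e) with hg₁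
    have hg₁e : g₁ e = 1 - g e := by simp [hg₁]; ring
    have hg₁ne : ∀ e', e' ≠ e → g₁ e' = g e' := fun e' h => by simp [hg₁, Pi.single_eq_of_ne h]
    have hnet : ∀ x, I.net g₁ x =
        I.net g x + ((if u = x then 1 else 0) - if w = x then 1 else 0) := by
      intro x
      rw [hg₁, net_add, net_single]
      rcases he with ⟨h0, rfl, rfl⟩ | ⟨h0, rfl, rfl⟩
      · rw [h0]; norm_num
      · rw [h0]; split_ifs <;> norm_num
    have h01 : ∀ e', g₁ e' = 0 ∨ g₁ e' = 1 := by
      intro e'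
      by_cases h : e' = e
      · rw [h, hg₁e]
        rcases hg e with h | h <;> simp [h]
      · rw [hg₁ne e' h]; exact hg e'
    have hrel : ReflTransGen
        (fun a b => I.Residual g₁ a b ∧ a ∉ insert u A ∧ b ∉ insert u A) w v := by
      refine ReflTransGen.mono ?_ _ _ hwv
      rintro a b ⟨⟨⟨e', he'⟩, ha, hb⟩, hau, hbu⟩
      refine ⟨⟨e', ?_⟩, by simp [hau, ha], by simp [hbu, hb]⟩
      -- `e` has the end `u`, which the rest of the path avoids; its residual arcs therefore survive
      -- the flip.
      have : e' ≠ e := by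
        rintro rfl
        rcases he with ⟨-, h1, -⟩ | ⟨-, h1, -⟩ <;> rcases he' with ⟨-, h2, h3⟩ | ⟨-, h2, h3⟩ <;>
          simp_all
      rwa [hg₁ne e' this]
    obtain ⟨g', hg', hn'⟩ := ih _ hlt (insert u A) g₁ h01 w hrel rfl
    refine ⟨g', hg', fun x => ?_⟩
    rw [hn', hnet]; ring

open Classical in
/-- Below the value of a real flow there are `0`-`1` valued flows of every integral value. -/
theorem IsFlow.exists_integral [Finite V] {I : MultipleUnicast V E n} {s t : V} {f : E → ℝ}
    (hf : I.IsFlow s t f) (k : ℕ) (hk : k ≤ I.net f s) :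
    ∃ g : E → ℝ, (∀ e, g e = 0 ∨ g e = 1) ∧
      ∀ x, I.net g x = k * ((if s = x then 1 else 0) - if t = x then 1 else 0) := by
  have := Fintype.ofFinite V
  induction k with
  | zero => exact ⟨0, by simp, by simp [net, inflow, outflow]⟩
  | succ k ih =>
    have hk' : (k : ℝ) < I.net f s := by push_cast at hk; linarith
    have hst : s ≠ t := hf.ne (k.cast_nonneg.trans_lt hk').ne'
    obtain ⟨g, hg, hgn⟩ := ih hk'.le
    by_cases hreach : ReflTransGen (I.Residual g) s t
    · obtain ⟨g', hg', hn'⟩ := I.exists_augment ∅ g hg s t (by simpa using hreach)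
      refine ⟨g', hg', fun x => ?_⟩
      rw [hn', hgn]; push_cast; ring
    · exfalso
      -- Max-flow min-cut: `g` is 1 on the edges leaving `S` and 0 on those entering, so no flow
      -- across this cut exceeds `k`.
      set S := Finset.univ.filter fun v => ReflTransGen (I.Residual g) s v with hS
      have hsS : s ∈ S := by simp [hS, ReflTransGen.refl]
      have htS : t ∉ S := by simpa [hS] using hreach
      have h1 := hf.sum_net_eq hsS (Or.inl htS)
      have h2 : ∑ v ∈ S, I.net g v = k := by
        rw [Finset.sum_eq_single_of_mem s hsS]
        · rw [hgn]; simp [hst.symm]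
        · intro v hv hvs
          have : t ≠ v := by rintro rfl; exact htS hv
          rw [hgn]; simp [this, Ne.symm hvs]
      rw [sum_net] at h1 h2
      have h3 : ∑ e, ((if I.tail e ∈ S then f e else 0) - if I.head e ∈ S then f e else 0) ≤
          ∑ e, ((if I.tail e ∈ S then g e else 0) - if I.head e ∈ S then g e else 0) := by
        refine Finset.sum_le_sum fun e _ => ?_
        have hout : I.tail e ∈ S → I.head e ∉ S → g e = 1 := by
          intro ha hb
          rcases hg e with h | h
          · simp only [hS, Finset.mem_filter, Finset.mem_univ, true_and] at ha hb
            exact absurd (ha.tail ⟨e, Or.inl ⟨h, rfl, rfl⟩⟩) hb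
          · exact h
        have hin : I.tail e ∉ S → I.head e ∈ S → g e = 0 := by
          intro ha hb
          rcases hg e with h | h
          · exact h
          · simp only [hS, Finset.mem_filter, Finset.mem_univ, true_and] at ha hb
            exact absurd (hb.tail ⟨e, Or.inr ⟨h, rfl, rfl⟩⟩) ha
        have h4 := hf.nonneg e
        have h5 := hf.le_one e
        split_ifs with a b b
        · linarith
        · linarith [hout a b]
        · linarith [hin a b]
        · linarith
      linarith

/-- The node where an edge, or a message of the source `s`, becomes available. -/
def arrival (I : MultipleUnicast V E n) (D : Set E) (s : V) (k : ℕ) : D ⊕ Fin k → V :=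
  Sum.elim (fun e => I.head e) fun _ => s

/-- The node where an edge starts, or a message leaves the network at `t`. -/
def departure (I : MultipleUnicast V E n) (D : Set E) (t : V) (k : ℕ) : D ⊕ Fin k → V :=
  Sum.elim (fun e => I.tail e) fun _ => t

/-- A flow of value `k` decomposes into paths: there are a set `D` of edges and a bijection `φ`
that takes each edge of `D` to its successor on its path (or to the number of a path that ends
with it) and the number of a path to its first edge. -/
theorem IsFlow.exists_linking [Finite V] {I : MultipleUnicast V E n} {s t : V} {f : E → ℝ}
    (hf : I.IsFlow s t f) (k : ℕ) (hk : k ≤ I.net f s) :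
    ∃ (D : Set E) (φ : D ⊕ Fin k ≃ D ⊕ Fin k),
      ∀ x, I.departure D t k (φ x) = I.arrival D s k x := by
  classical
  obtain ⟨g, hg, hgn⟩ := hf.exists_integral k hk
  let D : Set E := {e | g e = 1}
  -- The `k` extra arrivals at `s` and departures at `t` balance every node; the bijections at the
  -- single nodes then glue to `φ`.
  have hcard : ∀ v, Fintype.card {x // I.arrival D s k x = v} =
      Fintype.card {x // I.departure D t k x = v} := by
    intro v
    have hgD : ∀ e, g e = if e ∈ D then 1 else 0 := by
      intro e
      rcases hg e with h | h <;> simp [D, h]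
    have h1 := hgn v
    rw [net, outflow, inflow] at h1
    simp only [hgD, Finset.sum_filter] at h1
    have aux : ∀ (p : E → V) (w : V), (Fintype.card {x : D ⊕ Fin k //
        Sum.elim (fun e : D => p e) (fun _ => w) x = v} : ℝ) =
        (∑ e, if p e = v then (if e ∈ D then (1 : ℝ) else 0) else 0) +
          k * (if w = v then 1 else 0) := by
      intro p w
      rw [Fintype.card_subtype, Finset.card_filter]
      push_cast
      rw [Fintype.sum_sum_type]
      refine congrArg₂ (· + ·) (Eq.trans (b := ∑ a : D, if p a = v then (1 : ℝ) else 0)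
        (Finset.sum_congr rfl fun a _ => by congr) ?_) ?_
      · rw [← Finset.sum_subtype (Finset.univ.filter (· ∈ D)) (by simp)
          fun e => if p e = v then (1 : ℝ) else 0, Finset.sum_filter]
        refine Finset.sum_congr rfl fun e _ => ?_
        split_ifs <;> rfl
      · by_cases hw : w = v <;> simp [hw]
    have h2 := aux I.head s
    have h3 := aux I.tail t
    unfold arrival departure
    rw [← Nat.cast_inj (R := ℝ), h2, h3]
    linarith
  refine ⟨D, Equiv.ofFiberEquiv fun v => Fintype.equivOfCardEq (hcard v), fun x => ?_⟩
  exact Equiv.ofFiberEquiv_map _ _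

end Flows

/-! ### Integral codes for one path and a system of edge-disjoint paths -/

section IntegralCodes

variable {V E : Type*} {n : ℕ}

theorem Adj.not_reachable {I : MultipleUnicast V E n} {a b : V} (h : I.Adj a b) :
    ¬ ReflTransGen I.Adj b a :=
  fun h' => I.acyclic a (TransGen.head' h h')

/-- The edge `e` can be reached from the end of the edge `e'`. -/
def Before (I : MultipleUnicast V E n) (e' e : E) : Prop :=
  ReflTransGen I.Adj (I.head e') (I.tail e)

theorem before_of_eq {I : MultipleUnicast V E n} {e' e : E} (h : I.head e' = I.tail e) :
    I.Before e' e := by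
  rw [Before, h]

instance (I : MultipleUnicast V E n) : IsTrans E I.Before where
  trans _ b _ hab hbc := (hab.tail ⟨b, rfl, rfl⟩).trans hbc

instance (I : MultipleUnicast V E n) : Std.Irrefl I.Before where
  irrefl e := Adj.not_reachable ⟨e, rfl, rfl⟩

/-- Acyclicity makes `Before` a strict order. Signals are determined downstream; the reverse order
serves arguments that go back from the ends of the paths or follow a path to its end. -/
theorem wellFounded_before [Finite E] (I : MultipleUnicast V E n) : WellFounded I.Before :=
  Finite.wellFounded_of_trans_of_irrefl _

theorem wellFounded_after [Finite E] (I : MultipleUnicast V E n) :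
    WellFounded (Function.swap I.Before) :=
  Finite.wellFounded_of_trans_of_irrefl _

/-- A rule that determines the signal on each edge from the signals on the edges entering its tail
has a solution. -/
theorem exists_eq_of_local [Finite E] (I : MultipleUnicast V E n) {M : Type*} [Zero M]
    (F : (E → M) → E → M)
    (hF : ∀ f G G', (∀ e, I.head e = I.tail f → G e = G' e) → F G f = F G' f) :
    ∃ G, ∀ f, G f = F G f := by
  classical
  -- The default 0 is immaterial: by `hF`, only edges entering the tail of `f` matter.
  let G : E → M := I.wellFounded_before.fix fun f rec =>
    F (fun e => if h : I.head e = I.tail f then rec e (before_of_eq h) else 0) f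
  refine ⟨G, fun f => ?_⟩
  have := I.wellFounded_before.fix_eq (C := fun _ => M) (fun f rec =>
    F (fun e => if h : I.head e = I.tail f then rec e (before_of_eq h) else 0) f) f
  refine this.trans (hF _ _ _ fun e he => ?_)
  simp [he, G]

open Classical in
/-- `m` is an integral combination of the signals `G` on the edges entering `v`, of the messages of
the source `s` if `v = s`, and of the message of the source `s'` if `v = s'`. -/
def Available [Fintype E] (I : MultipleUnicast V E n) (s' s : V) {k : ℕ}
    (G : E → (Fin k → ℤ) × ℤ) (v : V) (m : (Fin k → ℤ) × ℤ) : Prop :=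
  ∃ (a : E → ℤ) (b : Fin k → ℤ) (c : ℤ), m = ∑ e with I.head e = v, a e • G e +
    ((if v = s then b else 0, if v = s' then c else 0) : (Fin k → ℤ) × ℤ)

section

variable [Fintype E] {I : MultipleUnicast V E n} {s' s : V} {k : ℕ}
  {G : E → (Fin k → ℤ) × ℤ} {v : V}

theorem Available.add {m m' : (Fin k → ℤ) × ℤ} (h : I.Available s' s G v m)
    (h' : I.Available s' s G v m') : I.Available s' s G v (m + m') := by
  obtain ⟨a, b, c, rfl⟩ := h
  obtain ⟨a', b', c', rfl⟩ := h'
  refine ⟨a + a', b + b', c + c', ?_⟩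
  simp only [Pi.add_apply, add_smul, Finset.sum_add_distrib]
  split_ifs <;> ext <;> simp <;> ring

theorem Available.smul {m : (Fin k → ℤ) × ℤ} (r : ℤ) (h : I.Available s' s G v m) :
    I.Available s' s G v (r • m) := by
  obtain ⟨a, b, c, rfl⟩ := h
  refine ⟨r • a, r • b, r • c, ?_⟩
  simp only [Pi.smul_apply, smul_assoc, smul_add, Finset.smul_sum]
  split_ifs <;> simp

theorem available_zero : I.Available s' s G v 0 :=
  ⟨0, 0, 0, by ext <;> simp⟩

theorem available_edge {e : E} (h : I.head e = v) : I.Available s' s G v (G e) := by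
  classical
  refine ⟨Pi.single e 1, 0, 0, ?_⟩
  rw [Finset.sum_eq_single e]
  · ext <;> simp
  · intro b _ hb
    simp [hb]
  · simp [h]

theorem available_source (b : Fin k → ℤ) : I.Available s' s G s (b, 0) :=
  ⟨0, b, 0, by ext <;> simp⟩

theorem available_source' : I.Available s' s G s' (0, 1) :=
  ⟨0, 0, 1, by ext <;> simp⟩

end

/-- The signal carried by an edge of `D`, or the message that enters a path. -/
def carried {k : ℕ} {D : Set E} (G : E → (Fin k → ℤ) × ℤ) : D ⊕ Fin k → (Fin k → ℤ) × ℤ :=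
  Sum.elim (fun e => G e) fun i => (Pi.single i 1, 0)

open Classical in
/-- The signal from the preceding edge on the path, for the edges on the paths. -/
noncomputable def inherited {k : ℕ} {D : Set E} (φ : D ⊕ Fin k ≃ D ⊕ Fin k)
    (G : E → (Fin k → ℤ) × ℤ) (f : E) : (Fin k → ℤ) × ℤ :=
  if h : f ∈ D then carried G (φ.symm (.inl ⟨f, h⟩)) else 0

theorem inherited_next {k : ℕ} {D : Set E} (φ : D ⊕ Fin k ≃ D ⊕ Fin k)
    (G : E → (Fin k → ℤ) × ℤ) {x : D ⊕ Fin k} {f : D}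
    (h : φ x = .inl f) : inherited φ G f = carried G x := by
  rw [inherited, dif_pos f.2, Subtype.coe_eta, ← h, Equiv.symm_apply_apply]

open Classical in
/-- The signal on the edge `o`; if there is none, the message of `s'` at that node. -/
noncomputable def relayed {k : ℕ} (s' : V) (G : E → (Fin k → ℤ) × ℤ) (o : Option E) (v : V) :
    (Fin k → ℤ) × ℤ :=
  o.elim (if v = s' then (0, 1) else 0) G

/-- The code in which each edge sends what it inherits along the paths `φ` plus `lam` times what
the parent edge of its tail relays. -/
theorem exists_code [Fintype E] (I : MultipleUnicast V E n) (s' : V) {s t : V} {k : ℕ} {D : Set E}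
    {φ : D ⊕ Fin k ≃ D ⊕ Fin k} (hφ : ∀ x, I.departure D t k (φ x) = I.arrival D s k x)
    (par : V → Option E) (hpar : ∀ v f, par v = some f → I.head f = v) (lam : E → ℤ) :
    ∃ G : E → (Fin k → ℤ) × ℤ, (∀ f, I.Available s' s G (I.tail f) (G f)) ∧
      ∀ f, G f = inherited φ G f + lam f • relayed s' G (par (I.tail f)) (I.tail f) := by
  have harr : ∀ f (h : f ∈ D), I.arrival D s k (φ.symm (.inl ⟨f, h⟩)) = I.tail f := by
    intro f h
    rw [← hφ, Equiv.apply_symm_apply]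
    rfl
  obtain ⟨G, hG⟩ := I.exists_eq_of_local (M := (Fin k → ℤ) × ℤ)
    (fun G f => inherited φ G f + lam f • relayed s' G (par (I.tail f)) (I.tail f)) (by
      intro f G G' h
      refine congrArg₂ (· + ·) ?_ (congrArg _ ?_)
      · unfold inherited
        split_ifs with hf
        · have := harr f hf
          rcases hx : φ.symm (.inl ⟨f, hf⟩) with e | i
          · rw [hx] at this
            exact h e this
          · rfl
        · rfl
      · rcases hp : par (I.tail f) with _ | e
        · rfl
        · exact h e (hpar _ _ hp))
  refine ⟨G, fun f => ?_, hG⟩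
  rw [hG f]
  refine Available.add ?_ (Available.smul _ ?_)
  · unfold inherited
    split_ifs with hf
    · have := harr f hf
      rcases hx : φ.symm (.inl ⟨f, hf⟩) with e | i
      · rw [hx] at this
        exact available_edge this
      · rw [hx] at this
        rw [← this]
        exact available_source _
    · exact available_zero
  · rcases hp : par (I.tail f) with _ | e
    · simp only [relayed, Option.elim]
      split_ifs with h
      · rw [h]; exact available_source'
      · exact available_zero
    · exact available_edge (hpar _ _ hp)

/-- The edges at which the paths `φ` end. -/
theorem exists_final (I : MultipleUnicast V E n) {s t : V} (hst : s ≠ t) {k : ℕ} {D : Set E}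
    {φ : D ⊕ Fin k ≃ D ⊕ Fin k} (hφ : ∀ x, I.departure D t k (φ x) = I.arrival D s k x) :
    ∃ final : Fin k → D, (∀ j, I.head (final j) = t) ∧ ∀ j, φ (.inl (final j)) = .inr j := by
  have : ∀ j, ∃ e : D, I.head e = t ∧ φ (.inl e) = .inr j := by
    intro j
    rcases hx : φ.symm (.inr j) with e | i
    · have h1 : φ (.inl e) = .inr j := by rw [← hx, Equiv.apply_symm_apply]
      refine ⟨e, ?_, h1⟩
      have := hφ (.inl e)
      rw [h1] at this
      exact this.symm
    · have h1 : φ (.inr i) = .inr j := by rw [← hx, Equiv.apply_symm_apply]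
      have := hφ (.inr i)
      rw [h1] at this
      exact absurd this.symm hst
  choose final h1 h2 using this
  exact ⟨final, h1, h2⟩

section

variable [Fintype E] {I : MultipleUnicast V E n} {s' s t : V} {k : ℕ} {D : Set E}
  {φ : D ⊕ Fin k ≃ D ⊕ Fin k} {G : E → (Fin k → ℤ) × ℤ} {par : V → Option E} {lam : E → ℤ}

/-- If only even multiples are added to what the paths carry, the transfer matrix from the paths'
beginnings to their ends has an odd determinant. -/
theorem det_ne_zero (hst : s ≠ t) (hφ : ∀ x, I.departure D t k (φ x) = I.arrival D s k x)
    (hG : ∀ f, G f = inherited φ G f + lam f • relayed s' G (par (I.tail f)) (I.tail f))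
    (hlam : ∀ f ∈ D, Even (lam f)) (final : Fin k → D) (hfinal : ∀ j, φ (.inl (final j)) = .inr j) :
    (Matrix.of fun j i => (G (final j)).1 i).det ≠ 0 := by
  intro h0
  -- Modulo 2 each path just forwards its message. A kernel vector `w` gives a functional `l` that
  -- vanishes at the ends, hence back along the paths, hence on the messages.
  have h1 : ((Matrix.of fun j i => (G (final j)).1 i).map (Int.castRingHom (ZMod 2))).det = 0 := by
    rw [← RingHom.mapMatrix_apply, ← RingHom.map_det, h0, map_zero]
  obtain ⟨w, hw, hmul⟩ := Matrix.exists_mulVec_eq_zero_iff.2 h1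
  apply hw
  let l : (Fin k → ℤ) × ℤ → ZMod 2 := fun m => ∑ i, (m.1 i : ZMod 2) * w i
  have hl : ∀ f : D, l (G f) = l (inherited φ G f) := by
    intro f
    obtain ⟨r, hr⟩ := hlam f f.2
    have h2 : (2 : ZMod 2) = 0 := rfl
    conv_lhs => rw [hG f, hr]
    refine Finset.sum_congr rfl fun i _ => ?_
    simp only [Prod.fst_add, Prod.smul_fst, Pi.add_apply, Pi.smul_apply, smul_eq_mul]
    push_cast
    rw [← two_mul, h2]
    simp
  have hfinal0 : ∀ j, l (G (final j)) = 0 := fun j => congrFun hmul j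
  have hzero : ∀ f : E, ∀ hf : f ∈ D, l (G f) = 0 := by
    intro f
    induction f using I.wellFounded_after.induction with
    | _ f ih =>
      intro hf
      rcases hx : φ (.inl ⟨f, hf⟩) with f' | j
      · have h3 := hφ (.inl ⟨f, hf⟩)
        rw [hx] at h3
        have h4 := ih f' (before_of_eq h3.symm) f'.2
        rwa [hl, inherited_next φ G hx] at h4
      · have : (⟨f, hf⟩ : D) = final j :=
            Sum.inl_injective (φ.injective (hx.trans (hfinal j).symm))
        have h3 := hfinal0 j
        rwa [← this] at h3
  ext i
  rcases hx : φ (.inr i) with f | j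
  · have h3 := hzero f f.2
    rw [hl, inherited_next φ G hx] at h3
    simpa [l, carried, Pi.single_apply] using h3
  · have h3 := hφ (.inr i)
    rw [hx] at h3
    exact absurd h3.symm hst

/-- The signals on the edges of a tree of edges outside the paths are that at its root. -/
theorem eq_root (hG : ∀ f, G f = inherited φ G f + lam f • relayed s' G (par (I.tail f)) (I.tail f))
    (hlam : ∀ f ∉ D, lam f = 1) {W : V → Prop} {w₀ : V}
    (hpar : ∀ v, W v → v ≠ w₀ → ∃ f, par v = some f ∧ I.head f = v ∧ f ∉ D ∧ W (I.tail f))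
    (f : E) (hf : f ∉ D) (hW : W (I.tail f)) : G f = relayed s' G (par w₀) w₀ := by
  induction f using I.wellFounded_before.induction with
  | _ f ih =>
    have h1 := hG f
    rw [hlam f hf, inherited, dif_neg hf, zero_add, one_smul] at h1
    rw [h1]
    by_cases h : I.tail f = w₀
    · rw [h]
    · obtain ⟨f', hf', hh, hD, hW'⟩ := hpar _ hW h
      rw [hf']
      exact ih f' (before_of_eq hh) hD hW'

/-- Everything mixed in has a nonnegative coefficient of the message of `s'`, so these contributions
never cancel. This is the reason for working over ℤ rather than over a finite field. -/
theorem nonneg_snd (hpar : ∀ v f, par v = some f → I.head f = v)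
    (hφ : ∀ x, I.departure D t k (φ x) = I.arrival D s k x)
    (hG : ∀ f, G f = inherited φ G f + lam f • relayed s' G (par (I.tail f)) (I.tail f))
    (hlam : ∀ f, 0 ≤ lam f) (f : E) :
    0 ≤ (inherited φ G f).2 ∧ 0 ≤ (relayed s' G (par (I.tail f)) (I.tail f)).2 ∧ 0 ≤ (G f).2 := by
  induction f using I.wellFounded_before.induction with
  | _ f ih =>
    have h1 : 0 ≤ (inherited φ G f).2 := by
      unfold inherited
      split_ifs with hf
      · rcases hx : φ.symm (.inl ⟨f, hf⟩) with e | i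
        · have h2 := hφ (.inl e)
          rw [← hx, Equiv.apply_symm_apply] at h2
          rw [hx] at h2
          exact (ih e (before_of_eq h2.symm)).2.2
        · exact le_rfl
      · exact le_rfl
    have h2 : 0 ≤ (relayed s' G (par (I.tail f)) (I.tail f)).2 := by
      rcases hx : par (I.tail f) with _ | e
      · simp only [relayed, Option.elim]
        split_ifs <;> simp
      · exact (ih e (before_of_eq (hpar _ _ hx))).2.2
    refine ⟨h1, h2, ?_⟩
    rw [hG f]
    exact add_nonneg h1 (mul_nonneg (hlam f) h2)

end

/-- An integral linear code in which the signal on some edge `r` into `t'` depends on the message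
of `s'`, the messages of `s` reach `t` with full rank, and either one of the signals that reach `t`
is that on `r` or they do not depend on the message of `s'`. -/
def HasIntegralCode [Fintype E] (I : MultipleUnicast V E n) (s' t' s t : V) (k : ℕ) : Prop :=
  ∃ G : E → (Fin k → ℤ) × ℤ, (∀ f, I.Available s' s G (I.tail f) (G f)) ∧
    ∃ r, I.head r = t' ∧ (G r).2 ≠ 0 ∧ ∃ final : Fin k → E, (∀ j, I.head (final j) = t) ∧
      (Matrix.of fun j i => (G (final j)).1 i).det ≠ 0 ∧
      ((∃ j, G (final j) = G r) ∨ ∀ j, (G (final j)).2 = 0)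

/-- A path outside `D`, or the last edge of `D` on a path. -/
theorem exists_last {I : MultipleUnicast V E n} (D : Set E) {a b : V}
    (h : ReflTransGen I.Adj a b) :
    ReflTransGen (fun a b => ∃ f, f ∉ D ∧ I.tail f = a ∧ I.head f = b) a b ∨
    ∃ e ∈ D, ReflTransGen I.Adj a (I.tail e) ∧
      ReflTransGen (fun a b => ∃ f, f ∉ D ∧ I.tail f = a ∧ I.head f = b) (I.head e) b := by
  induction h using ReflTransGen.head_induction_on with
  | refl => exact Or.inl .refl
  | @head a c hac _ ih =>
    rcases ih with ih | ⟨e, he, h1, h2⟩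
    · obtain ⟨f, rfl, rfl⟩ := hac
      by_cases hf : f ∈ D
      · exact Or.inr ⟨f, hf, .refl, ih⟩
      · exact Or.inl (ih.head ⟨f, hf, rfl, rfl⟩)
    · exact Or.inr ⟨e, he, h1.head hac, h2⟩

/-- The integral code for the case of a path from `s'` to `t'` outside the paths. -/
theorem hasIntegralCode_of_free [Fintype E] (I : MultipleUnicast V E n) {s' t' s t : V}
    (hst' : s' ≠ t') (hst : s ≠ t) {k : ℕ} {D : Set E}
    {φ : D ⊕ Fin k ≃ D ⊕ Fin k} (hφ : ∀ x, I.departure D t k (φ x) = I.arrival D s k x)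
    (h : ReflTransGen (fun a b => ∃ f, f ∉ D ∧ I.tail f = a ∧ I.head f = b) s' t') :
    I.HasIntegralCode s' t' s t k := by
  classical
  set W : V → Prop :=
    ReflTransGen (fun a b => ∃ f, f ∉ D ∧ I.tail f = a ∧ I.head f = b) s'
  have hback : ∀ v, W v → v ≠ s' → ∃ f, I.head f = v ∧ f ∉ D ∧ W (I.tail f) := by
    intro v hv hne
    rcases ReflTransGen.cases_tail hv with rfl | ⟨c, hc, f, hf, rfl, rfl⟩
    · exact absurd rfl hne
    · exact ⟨f, rfl, hf, hc⟩
  -- Parents lead back to `s'` outside `D`; `none` at `s'` makes it relay its own message.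
  have hpar : ∀ v, ∃ o : Option E, (∀ f, o = some f → I.head f = v) ∧ (v = s' → o = none) ∧
      (W v → v ≠ s' → ∃ f, o = some f ∧ I.head f = v ∧ f ∉ D ∧ W (I.tail f)) := by
    intro v
    by_cases hv : W v ∧ v ≠ s'
    · obtain ⟨f, hf, hD, hW⟩ := hback v hv.1 hv.2
      refine ⟨some f, ?_, fun h => absurd h hv.2, fun _ _ => ⟨f, rfl, hf, hD, hW⟩⟩
      rintro _ ⟨⟩
      exact hf
    · exact ⟨none, by simp, by simp, fun h1 h2 => absurd ⟨h1, h2⟩ hv⟩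
  choose par hpar₁ hpar₂ hpar₃ using hpar
  obtain ⟨G, hloc, hG⟩ := I.exists_code s' hφ par hpar₁ fun f => if f ∈ D then 0 else 1
  obtain ⟨final, hfinal₁, hfinal₂⟩ := I.exists_final hst hφ
  obtain ⟨r, hr, hrD, hrW⟩ := hback t' h hst'.symm
  have hGr := eq_root hG (fun f hf => by simp [hf]) hpar₃ r hrD hrW
  refine ⟨G, hloc, r, hr, ?_, fun j => final j, hfinal₁,
    det_ne_zero hst hφ hG (fun f hf => by simp [hf]) final hfinal₂, Or.inr fun j => ?_⟩
  · rw [hGr, hpar₂ s' rfl]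
    simp [relayed]
  · have hzero : ∀ f : E, f ∈ D → (G f).2 = 0 := by
      intro f
      induction f using I.wellFounded_before.induction with
      | _ f ih =>
        intro hf
        rw [hG f, if_pos hf, zero_smul, add_zero, inherited, dif_pos hf]
        rcases hx : φ.symm (.inl ⟨f, hf⟩) with e | i
        · have h2 := hφ (.inl e)
          rw [← hx, Equiv.apply_symm_apply] at h2
          rw [hx] at h2
          exact ih e (before_of_eq h2.symm) e.2
        · rfl
    exact hzero _ (final j).2

/-- The integral code for the case of a path from `s'` to `t'` with last common edge `e` with the
paths. -/
theorem hasIntegralCode_of_last [Fintype E] (I : MultipleUnicast V E n) {s' t' s t : V}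
    (hst : s ≠ t) {k : ℕ} {D : Set E}
    {φ : D ⊕ Fin k ≃ D ⊕ Fin k} (hφ : ∀ x, I.departure D t k (φ x) = I.arrival D s k x)
    {e : E} (he : e ∈ D) (hse : ReflTransGen I.Adj s' (I.tail e))
    (h : ReflTransGen (fun a b => ∃ f, f ∉ D ∧ I.tail f = a ∧ I.head f = b) (I.head e) t') :
    I.HasIntegralCode s' t' s t k := by
  classical
  set W : V → Prop :=
    ReflTransGen (fun a b => ∃ f, f ∉ D ∧ I.tail f = a ∧ I.head f = b) (I.head e)
  have hWreach : ∀ v, W v → ReflTransGen I.Adj (I.head e) v := fun v hv =>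
    ReflTransGen.mono (fun a b ⟨f, _, h1, h2⟩ => ⟨f, h1, h2⟩) _ _ hv
  have hback : ∀ v, W v → v ≠ I.head e → ∃ f, I.head f = v ∧ f ∉ D ∧ W (I.tail f) := by
    intro v hv hne
    rcases ReflTransGen.cases_tail hv with rfl | ⟨c, hc, f, hf, rfl, rfl⟩
    · exact absurd rfl hne
    · exact ⟨f, rfl, hf, hc⟩
  -- In `W` parents lead back to `e` outside `D`; at nodes not reachable from `e` they lead back to
  -- `s'`.
  have hpar : ∀ v, ∃ o : Option E, (∀ f, o = some f → I.head f = v) ∧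
      (v = I.head e → o = some e) ∧
      (W v → v ≠ I.head e → ∃ f, o = some f ∧ I.head f = v ∧ f ∉ D ∧ W (I.tail f)) ∧
      (¬ ReflTransGen I.Adj (I.head e) v → ReflTransGen I.Adj s' v →
        (v = s' ∧ o = none) ∨ ∃ f, o = some f ∧ ReflTransGen I.Adj s' (I.tail f)) := by
    intro v
    by_cases hv : v = I.head e
    · refine ⟨some e, ?_, fun _ => rfl, fun _ h => absurd hv h, fun h => absurd (hv ▸ .refl) h⟩
      rintro _ ⟨⟩
      exact hv.symm
    by_cases hW : W v
    · obtain ⟨f, hf, hD, hW'⟩ := hback v hW hv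
      refine ⟨some f, ?_, fun h => absurd h hv, fun _ _ => ⟨f, rfl, hf, hD, hW'⟩,
        fun h => absurd (hWreach v hW) h⟩
      rintro _ ⟨⟩
      exact hf
    by_cases hs : v = s' ∨ ¬ ReflTransGen I.Adj s' v
    · refine ⟨none, by simp, fun h => absurd h hv, fun h => absurd h hW,
        fun _ h => Or.inl ⟨?_, rfl⟩⟩
      exact hs.resolve_right (not_not.2 h)
    · push Not at hs
      rcases ReflTransGen.cases_tail hs.2 with h | ⟨c, hc, f, rfl, rfl⟩
      · exact absurd h hs.1
      · refine ⟨some f, ?_, fun h => absurd h hv, fun h => absurd h hW,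
          fun _ _ => Or.inr ⟨f, rfl, hc⟩⟩
        rintro _ ⟨⟩
        rfl
  choose par hpar₁ hpar₂ hpar₃ hpar₄ using hpar
  -- On `D`, 2 mixes in the message of `s'` without changing the transfer matrix modulo 2, and 0
  -- preserves the signal of `e` down to `t`. Outside `D`, 1 is plain forwarding.
  let lam : E → ℤ := fun f => if f ∈ D then (if I.Before e f then 0 else 2) else 1
  have hlam : ∀ f, 0 ≤ lam f := by
    intro f
    simp only [lam]
    split_ifs <;> norm_num
  obtain ⟨G, hloc, hG⟩ := I.exists_code s' hφ par hpar₁ lam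
  obtain ⟨final, hfinal₁, hfinal₂⟩ := I.exists_final hst hφ
  have hr : ∃ r, I.head r = t' ∧ G r = G e := by
    by_cases ht : t' = I.head e
    · exact ⟨e, ht.symm, rfl⟩
    · obtain ⟨r, hr, hrD, hrW⟩ := hback t' h ht
      refine ⟨r, hr, ?_⟩
      rw [eq_root hG (fun f hf => by simp [lam, hf]) hpar₃ r hrD hrW, hpar₂ _ rfl]
      rfl
  obtain ⟨r, hr, hre⟩ := hr
  refine ⟨G, hloc, r, hr, ?_, fun j => final j, hfinal₁,
    det_ne_zero hst hφ hG (fun f hf => ?_) final hfinal₂, Or.inl ?_⟩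
  -- Not downstream of `e` the multiplier is positive, so positivity spreads from `s'`. It applies
  -- to `e` itself since `Before` is irreflexive.
  · have hpos : ∀ f, ReflTransGen I.Adj s' (I.tail f) → ¬ I.Before e f → 0 < (G f).2 := by
      intro f
      induction f using I.wellFounded_before.induction with
      | _ f ih =>
        intro h1 h2
        have h3 : 0 < (relayed s' G (par (I.tail f)) (I.tail f)).2 := by
          rcases hpar₄ _ h2 h1 with ⟨h, h'⟩ | ⟨f', h, h'⟩
          · rw [h', h]
            simp [relayed]
          · rw [h]
            have h4 := hpar₁ _ _ h
            refine ih f' (before_of_eq h4) h' fun h5 => h2 ?_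
            exact _root_.trans h5 (before_of_eq h4)
        have h4 := (nonneg_snd hpar₁ hφ hG hlam f).1
        rw [hG f]
        refine add_pos_of_nonneg_of_pos h4 (mul_pos ?_ h3)
        simp only [lam, if_neg h2]
        split_ifs <;> norm_num
    rw [hre]
    exact (hpos e hse (irrefl e)).ne'
  · simp only [lam, if_pos hf]
    split_ifs <;> simp
  -- After `e` its path has multiplier 0 and carries the same signal to its end.
  · have hfollow : ∀ f, ∀ hf : f ∈ D, G f = G r → ReflTransGen I.Adj (I.head e) (I.head f) →
        ∃ j, G (final j) = G r := by
      intro f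
      induction f using I.wellFounded_after.induction with
      | _ f ih =>
        intro hf h1 h2
        rcases hx : φ (.inl ⟨f, hf⟩) with f' | j
        · have h3 : I.tail f' = I.head f := by
            have := hφ (.inl ⟨f, hf⟩)
            rwa [hx] at this
          have h4 : I.Before e f' := by rwa [Before, h3]
          refine ih f' (before_of_eq h3.symm) f'.2 ?_ (h4.tail ⟨f', rfl, rfl⟩)
          rw [hG f', inherited_next φ G hx, ← h1]
          simp [lam, h4, carried]
        · have : (⟨f, hf⟩ : D) = final j :=
            Sum.inl_injective (φ.injective (hx.trans (hfinal₂ j).symm))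
          exact ⟨j, by rw [← this, ← h1]⟩
    exact hfollow e he hre.symm .refl

/-- Connectivity `1` from `s'` to `t'` and `k` from `s` to `t` yields an integral code. -/
theorem IsFlow.hasIntegralCode [Finite V] [Fintype E] {I : MultipleUnicast V E n} {s' t' s t : V}
    {f' f : E → ℝ} (hf' : I.IsFlow s' t' f') (hpos : 0 < I.net f' s') (hf : I.IsFlow s t f) {k : ℕ}
    (hk : 0 < k) (hkf : k ≤ I.net f s) : I.HasIntegralCode s' t' s t k := by
  have hst : s ≠ t := hf.ne ((Nat.cast_pos.2 hk).trans_le hkf).ne'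
  obtain ⟨D, φ, hφ⟩ := hf.exists_linking k hkf
  rcases exists_last D (hf'.reachable hpos) with h | ⟨e, he, h1, h2⟩
  · exact I.hasIntegralCode_of_free (hf'.ne hpos.ne') hst hφ h
  · exact I.hasIntegralCode_of_last hst hφ he h1 h2

end IntegralCodes

/-! ### Precoding at the source and reduction modulo a prime -/

section ScalarCodes

variable {V E : Type*} [Fintype E] {n : ℕ}

open Classical in
/-- A scalar linear code over `F` that serves the session from `s'` to `t'` at rate `1` and the
session from `s` to `t` at rate `m`. -/
def HasScalarCode (I : MultipleUnicast V E n) (s' t' s t : V) (F : Type*) [Field F]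
    (m : ℕ) : Prop :=
  ∃ (a : E → E → F) (b : E → Fin m → F) (c : E → F) (Y : (Fin m → F) → F → E → F),
    (∀ x y f, Y x y f = ∑ e with I.head e = I.tail f, a e f * Y x y e +
      ((if I.tail f = s then ∑ i, b f i * x i else 0) + if I.tail f = s' then c f * y else 0)) ∧
    (∀ x y x' y', (∀ e, I.head e = t' → Y x y e = Y x' y' e) → y = y') ∧
    ∀ x y x' y', (∀ e, I.head e = t → Y x y e = Y x' y' e) → x = x'

/-- An integral code gives scalar codes over the fields of almost all prime orders. -/
theorem HasIntegralCode.hasScalarCode {I : MultipleUnicast V E n} {s' t' s t : V} {m : ℕ}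
    (h : I.HasIntegralCode s' t' s t (m + 1)) :
    ∃ N : ℤ, N ≠ 0 ∧ ∀ p : ℕ, [Fact p.Prime] → (N : ZMod p) ≠ 0 →
      I.HasScalarCode s' t' s t (ZMod p) m := by
  classical
  obtain ⟨G, hloc, r, hr, hr0, final, hfinal, hdet, hor⟩ := h
  refine ⟨(G r).2 * (Matrix.of fun j i => (G (final j)).1 i).det, mul_ne_zero hr0 hdet, ?_⟩
  intro p _ hN
  rw [Int.cast_mul] at hN
  have hrp : ((G r).2 : ZMod p) ≠ 0 := left_ne_zero_of_mul hN
  have hdp := right_ne_zero_of_mul hN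
  -- The interference at `r`. The source `s` sends only vectors `z x` in the kernel of `l`, which
  -- has dimension at least `m`.
  let l : (Fin (m + 1) → ZMod p) →ₗ[ZMod p] ZMod p :=
    ∑ j, ((G r).1 j : ZMod p) • LinearMap.proj j
  have hl : ∀ z, l z = ∑ j, ((G r).1 j : ZMod p) * z j := by
    intro z
    simp [l, LinearMap.sum_apply]
  have hker : m ≤ Module.finrank (ZMod p) (LinearMap.ker l) := by
    have h1 := l.finrank_range_add_finrank_ker
    have h2 : Module.finrank (ZMod p) (LinearMap.range l) ≤ 1 := by
      simpa using (LinearMap.range l).finrank_le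
    rw [Module.finrank_fin_fun] at h1
    omega
  obtain ⟨w, hw⟩ := exists_linearIndependent_of_le_finrank hker
  let z : (Fin m → ZMod p) → Fin (m + 1) → ZMod p := fun x j => ∑ i, x i * (w i : _ → ZMod p) j
  have hzeq : ∀ x, z x = ((∑ i, x i • w i : LinearMap.ker l) : Fin (m + 1) → ZMod p) := by
    intro x
    ext j
    simp [z, Finset.sum_apply]
  have hzl : ∀ x, ∑ j, ((G r).1 j : ZMod p) * z x j = 0 := by
    intro x
    rw [← hl, hzeq]
    exact (∑ i, x i • w i : LinearMap.ker l).2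
  have hzinj : ∀ x x', z x = z x' → x = x' := by
    intro x x' hxx
    rw [hzeq, hzeq] at hxx
    have h1 := Subtype.ext hxx
    ext i
    have h2 := Fintype.linearIndependent_iff.1 hw (fun i => x i - x' i) (by
      simp [sub_smul, Finset.sum_sub_distrib, h1]) i
    exact sub_eq_zero.1 h2
  choose α β γ hαβγ using hloc
  let Y : (Fin m → ZMod p) → ZMod p → E → ZMod p := fun x y e =>
    ∑ j, ((G e).1 j : ZMod p) * z x j + ((G e).2 : ZMod p) * y
  have hYr : ∀ x y, Y x y r = ((G r).2 : ZMod p) * y := by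
    intro x y
    simp only [Y, hzl, zero_add]
  refine ⟨fun e f => α f e, fun f i => ∑ j, (β f j : ZMod p) * (w i : _ → ZMod p) j,
    fun f => γ f, Y, fun x y f => ?_, fun x y x' y' hxy => ?_, fun x y x' y' hxy => ?_⟩
  · have h1 : ∀ j, (G f).1 j = ∑ e with I.head e = I.tail f, α f e * (G e).1 j +
        if I.tail f = s then β f j else 0 := by
      intro j
      conv_lhs => rw [hαβγ f]
      simp only [Prod.fst_add, Prod.fst_sum, Pi.add_apply, Finset.sum_apply, Prod.smul_fst,
        Pi.smul_apply, smul_eq_mul]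
      split_ifs <;> rfl
    have h2 : (G f).2 = ∑ e with I.head e = I.tail f, α f e * (G e).2 +
        if I.tail f = s' then γ f else 0 := by
      conv_lhs => rw [hαβγ f]
      simp only [Prod.snd_add, Prod.snd_sum, Prod.smul_snd, smul_eq_mul]
    have h3 : ∑ i, (∑ j, (β f j : ZMod p) * (w i : _ → ZMod p) j) * x i =
        ∑ j, (β f j : ZMod p) * z x j := by
      simp only [z, Finset.mul_sum, Finset.sum_mul]
      rw [Finset.sum_comm]
      exact Finset.sum_congr rfl fun j _ => Finset.sum_congr rfl fun i _ => by ring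
    rw [h3]
    simp only [Y, h1, h2]
    push_cast
    simp only [add_mul, mul_add, Finset.sum_add_distrib, Finset.sum_mul, Finset.mul_sum]
    rw [Finset.sum_comm]
    have h4 : ∑ j, ((if I.tail f = s then (β f j : ZMod p) else 0) * z x j) =
        if I.tail f = s then ∑ j, (β f j : ZMod p) * z x j else 0 := by
      split_ifs <;> simp
    have h5 : (if I.tail f = s' then (γ f : ZMod p) else 0) * y =
        if I.tail f = s' then (γ f : ZMod p) * y else 0 := by
      split_ifs <;> simp
    simp only [h4, h5, mul_assoc]
    ring
  · have h1 := hxy r hr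
    rw [hYr, hYr] at h1
    exact mul_left_cancel₀ hrp h1
  -- Either `t` sees the signal of `r` and so knows `y`, or `y` does not reach the ends of the
  -- paths.
  · have hy : ∀ j, ((G (final j)).2 : ZMod p) * y = ((G (final j)).2 : ZMod p) * y' := by
      rcases hor with ⟨j, hj⟩ | h0
      · have h1 := hxy _ (hfinal j)
        have h2 : ∀ x y, Y x y (final j) = Y x y r := fun x y => by simp only [Y, hj]
        rw [h2, h2, hYr, hYr] at h1
        intro j
        rw [mul_left_cancel₀ hrp h1]
      · intro j
        simp [h0 j]
    apply hzinj
    have hdet' :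
        ((Matrix.of fun j i => (G (final j)).1 i).map (Int.castRingHom (ZMod p))).det ≠ 0 := by
      rw [← RingHom.mapMatrix_apply, ← RingHom.map_det]
      exact hdp
    by_contra hne
    refine hdet' (Matrix.exists_mulVec_eq_zero_iff.1 ⟨z x - z x', sub_ne_zero.2 hne, ?_⟩)
    rw [Matrix.mulVec_sub, sub_eq_zero]
    ext j
    have h1 := hxy _ (hfinal j)
    simp only [Y, hy j] at h1
    exact add_right_cancel h1

end ScalarCodes

/-! ### Time sharing between the two scalar codes -/

open Classical in
/-- Two scalar codes, each serving the first session at rate `1` and one of the other two at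
rate `2`, combine to a code over two time units. -/
theorem hasVectorLinearSolution_of_scalar {V E : Type*} [Fintype E] (I : MultipleUnicast V E 3)
    {F : Type*} [Field F]
    (h₁ : I.HasScalarCode (I.source 0) (I.terminal 0) (I.source 1) (I.terminal 1) F 2)
    (h₂ : I.HasScalarCode (I.source 0) (I.terminal 0) (I.source 2) (I.terminal 2) F 2) :
    I.HasVectorLinearSolution F 2 := by
  obtain ⟨a, b, c, Y, hY, hY0, hY1⟩ := h₁
  obtain ⟨a', b', c', Y', hY', hY0', hY1'⟩ := h₂
  refine ⟨⟨fun e f => Matrix.diagonal ![a e f, a' e f], fun j f =>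
    ![Matrix.diagonal ![c f, c' f], Matrix.of ![b f, 0], Matrix.of ![0, b' f]] j⟩,
    fun X e => ![Y (X 1) (X 0 0) e, Y' (X 2) (X 0 1) e], fun X f => ?_, fun i => ?_⟩
  · have hs : ∀ j, (I.source j = I.tail f) = (I.tail f = I.source j) := fun j => propext eq_comm
    ext q
    rw [Finset.sum_filter (fun j => I.source j = I.tail f), Fin.sum_univ_three]
    simp only [Pi.add_apply, Finset.sum_apply, Matrix.mulVec_diagonal]
    fin_cases q
    · simp only [Fin.zero_eta, Matrix.cons_val_zero]
      rw [hY]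
      simp [ite_apply, dotProduct, hs]
      ring
    · simp only [Fin.mk_one, Matrix.cons_val_one]
      rw [hY']
      simp [ite_apply, dotProduct, hs]
      ring
  -- A decoder exists as soon as the received signals determine the message.
  · have key : Function.FactorsThrough (fun X : Fin 3 → Fin 2 → F => X i)
        fun X (e : {e : E // I.head e = I.terminal i}) =>
          ![Y (X 1) (X 0 0) e, Y' (X 2) (X 0 1) e] := by
      intro X X' h
      have h0 : ∀ e, I.head e = I.terminal i → Y (X 1) (X 0 0) e = Y (X' 1) (X' 0 0) e :=
        fun e he => congrFun (congrFun h ⟨e, he⟩) 0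
      have h1 : ∀ e, I.head e = I.terminal i → Y' (X 2) (X 0 1) e = Y' (X' 2) (X' 0 1) e :=
        fun e he => congrFun (congrFun h ⟨e, he⟩) 1
      fin_cases i
      · ext q
        fin_cases q
        · exact hY0 _ _ _ _ h0
        · exact hY0' _ _ _ _ h1
      · exact hY1 _ _ _ _ h0
      · exact hY1' _ _ _ _ h1
    obtain ⟨d, hd⟩ := (Function.factorsThrough_iff _).1 key
    exact ⟨d, fun X => (congrFun hd X).symm⟩

end MultipleUnicast

theorem mainTheorem6 {V E : Type*} [Finite V] [Fintype E] (I : MultipleUnicast V E 3)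
    (h : ![1, 3, 3] ≤ I.connectivityLevel) : I.IsFeasible := by
  have hflow : ∀ i, ∃ f, I.IsFlow (I.source i) (I.terminal i) f ∧
      (![1, 3, 3] : Fin 3 → ℝ) i ≤ I.net f (I.source i) := by
    intro i
    obtain ⟨f, hf, hv⟩ := (I.isGreatest_maxFlow (I.source i) (I.terminal i)).1
    exact ⟨f, hf, (h i).trans_eq hv.symm⟩
  obtain ⟨f₀, hf₀, h₀⟩ := hflow 0
  obtain ⟨f₁, hf₁, h₁⟩ := hflow 1
  obtain ⟨f₂, hf₂, h₂⟩ := hflow 2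
  have hpos : 0 < I.net f₀ (I.source 0) := one_pos.trans_le h₀
  obtain ⟨N₁, hN₁, hcode₁⟩ := (hf₀.hasIntegralCode hpos hf₁ (k := 2 + 1) (by norm_num)
    ((by norm_num : ((2 + 1 : ℕ) : ℝ) ≤ 3).trans h₁)).hasScalarCode
  obtain ⟨N₂, hN₂, hcode₂⟩ := (hf₀.hasIntegralCode hpos hf₂ (k := 2 + 1) (by norm_num)
    ((by norm_num : ((2 + 1 : ℕ) : ℝ) ≤ 3).trans h₂)).hasScalarCode
  -- A prime above |N₁ N₂| divides neither factor, so both codes live over the same field.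
  obtain ⟨p, hp, hprime⟩ := Nat.exists_infinite_primes ((N₁ * N₂).natAbs + 1)
  have := Fact.mk hprime
  have hN : ((N₁ * N₂ : ℤ) : ZMod p) ≠ 0 := by
    intro h0
    rw [ZMod.intCast_zmod_eq_zero_iff_dvd] at h0
    have := Nat.le_of_dvd (Int.natAbs_pos.2 (mul_ne_zero hN₁ hN₂)) (Int.natCast_dvd.1 h0)
    omega
  rw [Int.cast_mul] at hN
  exact ⟨ZMod p, inferInstance, inferInstance, 2, two_pos,
    I.hasVectorLinearSolution_of_scalar (hcode₁ p (left_ne_zero_of_mul hN))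
      (hcode₂ p (right_ne_zero_of_mul hN))⟩
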